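/- Let $\mathbf k$ be an algebraically closed field of characteristic $0$, let $\mathfrak g,\mathfrak h$ be Lie algebras over $\mathbf k$ (of any dimension), let $\phi:\mathfrak g\to\mathrm{Der}(\mathfrak h)$ be a homomorphism of Lie algebras, and let $T:\mathfrak h\to\mathfrak g$ be a relative Rota–Baxter operator (of weight $1$) with respect to $\phi$, that is, a linear map with $$[T(u),T(v)]_{\mathfrak g}=T\big(\phi(T(u))v-\phi(T(v))u+[u,v]_{\mathfrak h}\big)\qquad(u,v\in\mathfrak h).$$ Let $U(\mathfrak g),U(\mathfrak h)$ be the universal enveloping algebras with their usual Hopf algebra structures (elements of the Lie algebra are primitive), written $\Delta(u)=u_1\otimes u_2$. Let $\bar\phi:U(\mathfrak g)\to\mathrm{End}(U(\mathfrak h))$ be the algebra homomorphism for which $\bar\phi(x)$, $x\in\mathfrak g$, is the derivation of $U(\mathfrak h)$ extending $\phi(x)$, i.e. $\bar\phi(x)(y_1\cdots y_r)=\sum_i y_1\cdots y_{i-1}\,\phi(x)(y_i)\,y_{i+1}\cdots y_r$. It makes $U(\mathfrak h)$ a $U(\mathfrak g)$-module bialgebra: the action is a coalgebra homomorphism $U(\mathfrak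 g)\otimes U(\mathfrak h)\to U(\mathfrak h)$, $\bar\phi(x)(ab)=\bar\phi(x_1)(a)\,\bar\phi(x_2)(b)$ and $\bar\phi(x)(1)=\varepsilon(x)1$. Moreover $y\rhd_T z:=\phi(T(y))z$ is a post-Lie structure on $\mathfrak h$, i.e. $x\rhd_T[y,z]=[x\rhd_T y,z]+[y,x\rhd_T z]$ and $([x,y]+x\rhd_T y-y\rhd_T x)\rhd_T z=x\rhd_T(y\rhd_T z)-y\rhd_T(x\rhd_T z)$. Then there is a linear map $\bar T:U(\mathfrak h)\to U(\mathfrak g)$ with the following properties. 1. $\bar T$ is the unique relative Rota–Baxter operator with respect to $(U(\mathfrak h),\bar\phi)$ that extends $T$: it is the unique coalgebra homomorphism $U(\mathfrak h)\to U(\mathfrak g)$ that satisfies $$\bar T(a)\bar T(b)=\bar T\big(a_1\,\bar\phi(\bar T(a_2))(b)\big)\qquad(a,b\in U(\mathfrak h))$$ and $\bar T(y)=T(y)$ for all $y\in\mathfrak h$. 2. $\bar T$ is the unique linear map satisfying the recursion $$\bar T(1)=1,\qquad \bar T(yu)=T(y)\,\bar T(u)-\bar T\big(\bar\phi(T(y))(u)\big)\qquad(y\in\mathfrak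 h,\ u\in U(\mathfrak h)).$$ 3. The operation $u\rhd_{\bar T}v:=\bar\phi(\bar T(u))(v)$ makes $U(\mathfrak h)$ a post-Hopf algebra: $\rhd_{\bar T}:U(\mathfrak h)\otimes U(\mathfrak h)\to U(\mathfrak h)$ is a coalgebra homomorphism, $x\rhd_{\bar T}(yz)=(x_1\rhd_{\bar T}y)(x_2\rhd_{\bar T}z)$, $x\rhd_{\bar T}(y\rhd_{\bar T}z)=\big(x_1(x_2\rhd_{\bar T}y)\big)\rhd_{\bar T}z$, and $x\mapsto(x\rhd_{\bar T}\cdot)$ is convolution invertible in $\mathrm{Hom}(U(\mathfrak h),\mathrm{End}(U(\mathfrak h)))$. 4. This post-Hopf structure coincides with the extension $\bar\rhd_T$ to $U(\mathfrak h)$ of the post-Lie structure $\rhd_T$, i.e. $\rhd_{\bar T}$ is the one and only bilinear operation $\bar\rhd$ on $U(\mathfrak h)$ such that, for all $x,z\in\mathfrak h$ and $u,v,w\in U(\mathfrak h)$, $$1\,\bar\rhd\,u=u,\quad x\,\bar\rhd\,1=0,\quad x\,\bar\rhd\,(zv)=(x\rhd_T z)v+z(x\,\bar\rhd\,v),\quad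 (xw)\,\bar\rhd\,u=x\,\bar\rhd\,(w\,\bar\rhd\,u)-(x\,\bar\rhd\,w)\,\bar\rhd\,u .$$ -/

import Mathlib

attribute [local instance 100] LieRing.ofAssociativeRing

/-! ### The Hopf algebra structure on a universal enveloping algebra -/

namespace UniversalEnvelopingAlgebra

section Hopf

open scoped TensorProduct

variable (k : Type*) [CommRing k] (L : Type*) [LieRing L] [LieAlgebra k L]

variable {k L} in
theorem induct {P : UniversalEnvelopingAlgebra k L → Prop}
    (algMap : ∀ r, P (algebraMap k _ r)) (gen : ∀ x, P (ι k x))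
    (mul : ∀ a b, P a → P b → P (a * b)) (add : ∀ a b, P a → P b → P (a + b))
    (a : UniversalEnvelopingAlgebra k L) : P a := by
  let S : Subalgebra k (UniversalEnvelopingAlgebra k L) :=
    { carrier := {a | P a}
      mul_mem' := fun {a b} ha hb => mul a b ha hb
      add_mem' := fun {a b} ha hb => add a b ha hb
      algebraMap_mem' := algMap }
  let f : L →ₗ⁅k⁆ S :=
    { toFun := fun x => ⟨ι k x, gen x⟩
      map_add' := fun x y => Subtype.ext (by simp)
      map_smul' := fun c x => Subtype.ext (by simp)
      map_lie' := fun {x y} => Subtype.ext (by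
        change ι k ⁅x, y⁆ = ι k x * ι k y - ι k y * ι k x
        rw [LieHom.map_lie, LieRing.of_associative_ring_bracket]) }
  have h : S.val.comp (lift k f) = AlgHom.id k _ := by
    apply hom_ext
    ext x
    simp only [LieHom.comp_apply, AlgHom.coe_toLieHom, AlgHom.comp_apply, lift_ι_apply]
    rfl
  have h2 := congrArg (fun g : _ →ₐ[k] _ => g a) h
  simp only [AlgHom.comp_apply, AlgHom.id_apply] at h2
  rw [← h2]
  exact (lift k f a).2

variable {k L} in
theorem algHom_ext_ι {A : Type*} [Ring A] [Algebra k A]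
    {f g : UniversalEnvelopingAlgebra k L →ₐ[k] A} (h : ∀ x, f (ι k x) = g (ι k x)) : f = g := by
  apply AlgHom.ext
  intro a
  induction a using induct with
  | algMap r => simp
  | gen x => exact h x
  | mul a b ha hb => rw [map_mul, map_mul, ha, hb]
  | add a b ha hb => rw [map_add, map_add, ha, hb]

/-- The comultiplication of `U(L)`: the algebra homomorphism with
`Δ x = x ⊗ 1 + 1 ⊗ x` for `x ∈ L`. -/
noncomputable def comulHom : UniversalEnvelopingAlgebra k L →ₐ[k]
    UniversalEnvelopingAlgebra k L ⊗[k] UniversalEnvelopingAlgebra k L :=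
  lift k
    { toFun := fun x => ι k x ⊗ₜ[k] 1 + 1 ⊗ₜ[k] ι k x
      map_add' := fun x y => by
        simp only [map_add, TensorProduct.add_tmul, TensorProduct.tmul_add]; abel
      map_smul' := fun c x => by
        simp only [map_smul, TensorProduct.smul_tmul', TensorProduct.tmul_smul, smul_add,
          RingHom.id_apply]
      map_lie' := fun {x y} => by
        simp only [LieHom.map_lie, LieRing.of_associative_ring_bracket, mul_add, add_mul,
          Algebra.TensorProduct.tmul_mul_tmul, one_mul, mul_one, TensorProduct.sub_tmul,
          TensorProduct.tmul_sub]
        abel }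

/-- The counit of `U(L)`: the algebra homomorphism with `ε x = 0` for `x ∈ L`. -/
noncomputable def counitHom : UniversalEnvelopingAlgebra k L →ₐ[k] k :=
  lift k (0 : L →ₗ⁅k⁆ k)

theorem comulHom_ι (x : L) :
    comulHom k L (ι k x) = ι k x ⊗ₜ[k] 1 + 1 ⊗ₜ[k] ι k x := by
  rw [comulHom, lift_ι_apply]; rfl

theorem counitHom_ι (x : L) : counitHom k L (ι k x) = 0 := by
  rw [counitHom, lift_ι_apply]; rfl

noncomputable instance instBialgebra : Bialgebra k (UniversalEnvelopingAlgebra k L) :=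
  .ofAlgHom (comulHom k L) (counitHom k L)
    (by
      refine algHom_ext_ι fun x => ?_
      simp [comulHom_ι, Algebra.TensorProduct.one_def, TensorProduct.add_tmul,
        TensorProduct.tmul_add, -ι_apply]
      abel)
    (by
      refine algHom_ext_ι fun x => ?_
      simp [comulHom_ι, counitHom_ι, -ι_apply])
    (by
      refine algHom_ext_ι fun x => ?_
      simp [comulHom_ι, counitHom_ι, -ι_apply])

theorem comul_ι (x : L) : Coalgebra.comul (R := k) (ι k x) = ι k x ⊗ₜ[k] 1 + 1 ⊗ₜ[k] ι k x :=
  comulHom_ι k L x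

theorem counit_ι (x : L) : Coalgebra.counit (R := k) (ι k x) = 0 :=
  counitHom_ι k L x

/-- The antipode of `U(L)`, as an algebra homomorphism to the opposite algebra with
`x ↦ -x` for `x ∈ L`. -/
noncomputable def antipodeHom :
    UniversalEnvelopingAlgebra k L →ₐ[k] (UniversalEnvelopingAlgebra k L)ᵐᵒᵖ :=
  lift k
    { toFun := fun x => MulOpposite.op (-ι k x)
      map_add' := fun x y => by
        rw [map_add, neg_add, MulOpposite.op_add]
      map_smul' := fun c x => by
        rw [map_smul, ← smul_neg, MulOpposite.op_smul]; rfl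
      map_lie' := fun {x y} => by
        rw [LieHom.map_lie, LieRing.of_associative_ring_bracket,
          LieRing.of_associative_ring_bracket, ← MulOpposite.op_mul, ← MulOpposite.op_mul,
          ← MulOpposite.op_sub]
        simp only [neg_mul_neg, neg_sub] }

/-- The antipode of `U(L)`, as a linear map. -/
noncomputable def antipodeMap :
    UniversalEnvelopingAlgebra k L →ₗ[k] UniversalEnvelopingAlgebra k L :=
  (MulOpposite.opLinearEquiv k).symm.toLinearMap ∘ₗ (antipodeHom k L).toLinearMap

theorem antipodeMap_ι (x : L) : antipodeMap k L (ι k x) = -ι k x := by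
  simp only [antipodeMap, LinearMap.comp_apply, AlgHom.toLinearMap_apply, antipodeHom,
    lift_ι_apply]
  rfl

theorem antipodeMap_mul (a b : UniversalEnvelopingAlgebra k L) :
    antipodeMap k L (a * b) = antipodeMap k L b * antipodeMap k L a := by
  simp [antipodeMap]

theorem antipodeMap_algebraMap (r : k) :
    antipodeMap k L (algebraMap k _ r) = algebraMap k _ r := by
  simp [antipodeMap]

noncomputable instance instHopfAlgebra : HopfAlgebra k (UniversalEnvelopingAlgebra k L) where
  antipode := antipodeMap k L
  mul_antipode_rTensor_comul := by
    refine LinearMap.ext fun a => ?_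
    simp only [LinearMap.comp_apply, Algebra.linearMap_apply]
    induction a using induct with
    | algMap r =>
      simp [Bialgebra.comul_algebraMap, Algebra.TensorProduct.algebraMap_apply,
        antipodeMap_algebraMap]
    | gen x =>
      simp only [comul_ι, counit_ι, map_add, LinearMap.rTensor_tmul, LinearMap.mul'_apply,
        antipodeMap_ι, mul_one, map_zero]
      have : antipodeMap k L 1 = 1 := by simpa using antipodeMap_algebraMap k L 1
      simp [this]
    | add a b ha hb => simp only [map_add, ha, hb]
    | mul a b ha hb =>
      have key : ∀ s t : UniversalEnvelopingAlgebra k L ⊗[k] UniversalEnvelopingAlgebra k L,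
          ∀ r : k, LinearMap.mul' k _ ((antipodeMap k L).rTensor _ s) = algebraMap k _ r →
          LinearMap.mul' k _ ((antipodeMap k L).rTensor _ (s * t)) =
            r • LinearMap.mul' k _ ((antipodeMap k L).rTensor _ t) := by
        intro s t r hs
        induction t using TensorProduct.induction_on with
        | zero => simp
        | add t u ht hu => simp only [mul_add, map_add, ht, hu, smul_add]
        | tmul b c =>
          have : ∀ s : UniversalEnvelopingAlgebra k L ⊗[k] UniversalEnvelopingAlgebra k L,
              LinearMap.mul' k _ ((antipodeMap k L).rTensor _ (s * (b ⊗ₜ[k] c))) =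
              antipodeMap k L b * LinearMap.mul' k _ ((antipodeMap k L).rTensor _ s) * c := by
            intro s
            induction s using TensorProduct.induction_on with
            | zero => simp
            | add t u ht hu => simp only [mul_add, add_mul, map_add, ht, hu]
            | tmul d e => simp [antipodeMap_mul, mul_assoc]
          rw [this, hs, ← Algebra.commutes, mul_assoc, ← Algebra.smul_def]
          simp
      rw [Bialgebra.comul_mul, key _ _ _ ha, hb, Bialgebra.counit_mul, map_mul, Algebra.smul_def]
  mul_antipode_lTensor_comul := by
    refine LinearMap.ext fun a => ?_
    simp only [LinearMap.comp_apply, Algebra.linearMap_apply]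
    induction a using induct with
    | algMap r =>
      have : antipodeMap k L 1 = 1 := by simpa using antipodeMap_algebraMap k L 1
      simp [Bialgebra.comul_algebraMap, Algebra.TensorProduct.algebraMap_apply, this]
    | gen x =>
      simp only [comul_ι, counit_ι, map_add, LinearMap.lTensor_tmul, LinearMap.mul'_apply,
        antipodeMap_ι, one_mul, map_zero]
      have : antipodeMap k L 1 = 1 := by simpa using antipodeMap_algebraMap k L 1
      simp [this]
    | add a b ha hb => simp only [map_add, ha, hb]
    | mul a b ha hb =>
      have key : ∀ s t : UniversalEnvelopingAlgebra k L ⊗[k] UniversalEnvelopingAlgebra k L,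
          ∀ r : k, LinearMap.mul' k _ ((antipodeMap k L).lTensor _ t) = algebraMap k _ r →
          LinearMap.mul' k _ ((antipodeMap k L).lTensor _ (s * t)) =
            r • LinearMap.mul' k _ ((antipodeMap k L).lTensor _ s) := by
        intro s t r hs
        induction s using TensorProduct.induction_on with
        | zero => simp
        | add t u ht hu => simp only [add_mul, map_add, ht, hu, smul_add]
        | tmul b c =>
          have : ∀ s : UniversalEnvelopingAlgebra k L ⊗[k] UniversalEnvelopingAlgebra k L,
              LinearMap.mul' k _ ((antipodeMap k L).lTensor _ ((b ⊗ₜ[k] c) * s)) =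
              b * LinearMap.mul' k _ ((antipodeMap k L).lTensor _ s) * antipodeMap k L c := by
            intro s
            induction s using TensorProduct.induction_on with
            | zero => simp
            | add t u ht hu => simp only [mul_add, add_mul, map_add, ht, hu]
            | tmul d e => simp [antipodeMap_mul, mul_assoc]
          rw [this, hs, ← Algebra.commutes, mul_assoc, ← Algebra.smul_def]
          simp
      rw [Bialgebra.comul_mul, key _ _ _ hb, ha, Bialgebra.counit_mul, map_mul, Algebra.smul_def,
        Algebra.commutes]

end Hopf

/-! ### Extension of derivations and of actions by derivations -/

section Action

variable {k : Type*} [CommRing k] {L : Type*} [LieRing L] [LieAlgebra k L]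
  {M : Type*} [LieRing M] [LieAlgebra k M]

/-- The algebra homomorphism `U(M) → U(M) ⊕ ε U(M)` (with `ε² = 0`) such that
`y ↦ y + ε D(y)` for `y ∈ M`. -/
noncomputable def derHom (D : LieDerivation k M M) :
    UniversalEnvelopingAlgebra k M →ₐ[k]
      TrivSqZeroExt (UniversalEnvelopingAlgebra k M) (UniversalEnvelopingAlgebra k M) :=
  lift k
    { toFun := fun y => TrivSqZeroExt.inl (ι k y) + TrivSqZeroExt.inr (ι k (D y))
      map_add' := fun x y => by
        ext <;> simp [-ι_apply]
      map_smul' := fun c x => by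
        ext <;> simp [-ι_apply]
      map_lie' := fun {x y} => by
        ext
        · simp [-ι_apply, LieRing.of_associative_ring_bracket]
        · simp [-ι_apply, LieRing.of_associative_ring_bracket]
          abel }

/-- The derivation of the associative algebra `U(M)` that extends a derivation `D` of the Lie
algebra `M`; on products of elements of `M` it is given by
`y₁ ⋯ yᵣ ↦ ∑ᵢ y₁ ⋯ yᵢ₋₁ D(yᵢ) yᵢ₊₁ ⋯ yᵣ`, see `extDer_ι`, `extDer_one` and `extDer_mul`. -/
noncomputable def extDer (D : LieDerivation k M M) :
    Module.End k (UniversalEnvelopingAlgebra k M) where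
  toFun a := (derHom D a).snd
  map_add' a b := by simp
  map_smul' c a := by simp

theorem derHom_fst (D : LieDerivation k M M) (a : UniversalEnvelopingAlgebra k M) :
    (derHom D a).fst = a := by
  have h : (TrivSqZeroExt.fstHom k _ _).comp (derHom D) = AlgHom.id k _ := by
    apply hom_ext
    ext x
    simp only [LieHom.comp_apply, AlgHom.coe_toLieHom, AlgHom.comp_apply, derHom, lift_ι_apply]
    simp [-ι_apply]
  exact congrArg (fun g : _ →ₐ[k] _ => g a) h

theorem extDer_ι (D : LieDerivation k M M) (y : M) : extDer D (ι k y) = ι k (D y) := by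
  change (derHom D (ι k y)).snd = _
  rw [derHom, lift_ι_apply]
  simp [-ι_apply]

theorem extDer_one (D : LieDerivation k M M) : extDer D 1 = 0 := by
  change (derHom D 1).snd = _
  simp

theorem extDer_algebraMap (D : LieDerivation k M M) (r : k) :
    extDer D (algebraMap k _ r) = 0 := by
  rw [Algebra.algebraMap_eq_smul_one, map_smul, extDer_one, smul_zero]

theorem extDer_mul (D : LieDerivation k M M) (a b : UniversalEnvelopingAlgebra k M) :
    extDer D (a * b) = extDer D a * b + a * extDer D b := by
  change (derHom D (a * b)).snd = (derHom D a).snd * b + a * (derHom D b).snd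
  simp [derHom_fst, add_comm]

/-- The extension `φ̄ : U(L) → End(U(M))` of an action `φ : L → Der(M)` of a Lie algebra `L` on a
Lie algebra `M` by derivations: `φ̄` is a homomorphism of algebras, and for `x ∈ L` the map `φ̄(x)`
is the derivation of `U(M)` that extends `φ(x)`. -/
noncomputable def extAction (φ : L →ₗ⁅k⁆ LieDerivation k M M) :
    UniversalEnvelopingAlgebra k L →ₐ[k] Module.End k (UniversalEnvelopingAlgebra k M) :=
  lift k
    { toFun := fun x => extDer (φ x)
      map_add' := fun x y => by
        refine LinearMap.ext fun a => ?_
        rw [LinearMap.add_apply]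
        induction a using induct with
        | algMap r => simp only [extDer_algebraMap, add_zero]
        | gen x => simp only [extDer_ι, map_add, LieDerivation.add_apply]
        | mul a b ha hb => simp only [extDer_mul, ha, hb, mul_add, add_mul]; abel
        | add a b ha hb => simp only [map_add (extDer _), ha, hb]; abel
      map_smul' := fun c x => by
        refine LinearMap.ext fun a => ?_
        rw [LinearMap.smul_apply]
        induction a using induct with
        | algMap r => simp only [extDer_algebraMap, smul_zero]
        | gen x => simp only [extDer_ι, map_smul, LieDerivation.smul_apply, RingHom.id_apply]
        | mul a b ha hb =>
          simp only [extDer_mul, ha, hb, smul_add, smul_mul_assoc, mul_smul_comm]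
        | add a b ha hb => simp only [map_add (extDer _), ha, hb, smul_add]
      map_lie' := fun {x y} => by
        refine LinearMap.ext fun a => ?_
        rw [LieRing.of_associative_ring_bracket, LinearMap.sub_apply, Module.End.mul_apply,
          Module.End.mul_apply]
        induction a using induct with
        | algMap r => simp only [extDer_algebraMap, map_zero, sub_zero]
        | gen x => simp only [extDer_ι, LieHom.map_lie, LieDerivation.lie_apply, map_sub]
        | mul a b ha hb =>
          simp only [extDer_mul, ha, hb, map_add (extDer _), mul_sub, sub_mul]; abel
        | add a b ha hb => simp only [map_add (extDer _), ha, hb]; abel }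

theorem extAction_ι (φ : L →ₗ⁅k⁆ LieDerivation k M M) (x : L) :
    extAction φ (ι k x) = extDer (φ x) := by
  rw [extAction, lift_ι_apply]; rfl

end Action

end UniversalEnvelopingAlgebra

/-! ### Post-Lie algebras, post-Hopf algebras and relative Rota–Baxter operators -/

section Notions

open scoped TensorProduct

/-- A linear map `T : 𝔥 → 𝔤` is a relative Rota–Baxter operator (of weight 1) on the Lie algebra
`𝔤` with respect to the action `φ : 𝔤 → Der(𝔥)`. -/
def IsLieRelRotaBaxter {k 𝔤 𝔥 : Type*} [CommRing k] [LieRing 𝔤] [LieAlgebra k 𝔤]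
    [LieRing 𝔥] [LieAlgebra k 𝔥] (φ : 𝔤 →ₗ⁅k⁆ LieDerivation k 𝔥 𝔥) (T : 𝔥 →ₗ[k] 𝔤) : Prop :=
  ∀ u v : 𝔥, ⁅T u, T v⁆ = T (φ (T u) v - φ (T v) u + ⁅u, v⁆)

/-- A bilinear operation `x ▷ y = p x y` makes the Lie algebra `L` a post-Lie algebra. -/
structure IsPostLie {k L : Type*} [CommRing k] [LieRing L] [LieAlgebra k L]
    (p : L →ₗ[k] L →ₗ[k] L) : Prop where
  lie_right : ∀ x y z : L, p x ⁅y, z⁆ = ⁅p x y, z⁆ + ⁅y, p x z⁆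
  lie_left : ∀ x y z : L, p (⁅x, y⁆ + p x y - p y x) z = p x (p y z) - p y (p x z)

/-- The operation `u ▷ v = φ(T u) v` on `𝔥`. -/
def liePostProduct {k 𝔤 𝔥 : Type*} [CommRing k] [LieRing 𝔤] [LieAlgebra k 𝔤]
    [LieRing 𝔥] [LieAlgebra k 𝔥] (φ : 𝔤 →ₗ⁅k⁆ LieDerivation k 𝔥 𝔥) (T : 𝔥 →ₗ[k] 𝔤) :
    𝔥 →ₗ[k] 𝔥 →ₗ[k] 𝔥 :=
  LinearMap.mk₂ k (fun u v => φ (T u) v)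
    (fun _ _ _ => by simp) (fun _ _ _ => by simp) (fun _ _ _ => by simp) (fun _ _ _ => by simp)

/-- A linear map is a homomorphism of coalgebras. -/
def IsCoalgHom {k C D : Type*} [CommRing k] [AddCommGroup C] [Module k C] [Coalgebra k C]
    [AddCommGroup D] [Module k D] [Coalgebra k D] (f : C →ₗ[k] D) : Prop :=
  Coalgebra.counit ∘ₗ f = Coalgebra.counit (R := k) (A := C) ∧
    TensorProduct.map f f ∘ₗ Coalgebra.comul = Coalgebra.comul ∘ₗ f

/-- `sweedler f a` is `f(a₁, a₂)` in Sweedler notation, for a bilinear map `f`. -/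
noncomputable def sweedler {k C V : Type*} [CommRing k] [AddCommGroup C] [Module k C]
    [Coalgebra k C] [AddCommGroup V] [Module k V] (f : C →ₗ[k] C →ₗ[k] V) : C →ₗ[k] V :=
  TensorProduct.lift f ∘ₗ Coalgebra.comul

theorem sweedler_apply {k C V ι : Type*} [CommRing k] [AddCommGroup C] [Module k C]
    [Coalgebra k C] [AddCommGroup V] [Module k V] (f : C →ₗ[k] C →ₗ[k] V) {a : C}
    (r : Coalgebra.Repr k a ι) :
    sweedler f a = ∑ i ∈ r.index, f (r.left i) (r.right i) := by
  simp [sweedler, ← r.eq]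

/-- The algebra homomorphism `act : H → End(K)`, written `x ⇀ a = act x a`, makes the bialgebra `K`
a left `H`-module bialgebra. -/
structure IsModuleBialgebra {k H K : Type*} [CommRing k] [Ring H] [Bialgebra k H]
    [Ring K] [Bialgebra k K] (act : H →ₐ[k] Module.End k K) : Prop where
  /-- `x ⇀ (a b) = (x₁ ⇀ a) (x₂ ⇀ b)` -/
  act_mul : ∀ (x : H) (a b : K), act x (a * b) =
    sweedler ((LinearMap.mul k K).compl₁₂ (act.toLinearMap.flip a) (act.toLinearMap.flip b)) x
  /-- `x ⇀ 1 = ε(x) 1` -/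
  act_one : ∀ x : H, act x 1 = Coalgebra.counit (R := k) x • (1 : K)
  /-- `⇀ : H ⊗ K → K` is a homomorphism of coalgebras. -/
  isCoalgHom : IsCoalgHom (TensorProduct.lift act.toLinearMap)

/-- `K` is an `H`-module bialgebra via `act`, written `⇀`, and `T : K → H` is a relative
Rota–Baxter operator with respect to it: a homomorphism of coalgebras such that
`T(a) T(b) = T(a₁ (T(a₂) ⇀ b))`. -/
structure IsRelRotaBaxter {k H K : Type*} [CommRing k] [Ring H] [HopfAlgebra k H]
    [Ring K] [HopfAlgebra k K] (act : H →ₐ[k] Module.End k K) (T : K →ₗ[k] H) : Prop where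
  isModuleBialgebra : IsModuleBialgebra act
  isCoalgHom : IsCoalgHom T
  map_mul_map : ∀ a b : K,
    T a * T b = T (sweedler ((LinearMap.mul k K).compl₂ (act.toLinearMap.flip b ∘ₗ T)) a)

/-- The bilinear operation `a ▷ b = T(a) ⇀ b` on `K`. -/
noncomputable def hopfPostProduct {k H K : Type*} [CommRing k] [Ring H] [Algebra k H]
    [AddCommGroup K] [Module k K] (act : H →ₐ[k] Module.End k K) (T : K →ₗ[k] H) :
    K →ₗ[k] K →ₗ[k] K :=
  act.toLinearMap ∘ₗ T

/-- A bilinear operation `x ▷ y = p x y` makes the Hopf algebra `H` a post-Hopf algebra. -/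
structure IsPostHopf {k H : Type*} [CommRing k] [Ring H] [HopfAlgebra k H]
    (p : H →ₗ[k] H →ₗ[k] H) : Prop where
  /-- `▷ : H ⊗ H → H` is a homomorphism of coalgebras. -/
  isCoalgHom : IsCoalgHom (TensorProduct.lift p)
  /-- `x ▷ (y z) = (x₁ ▷ y) (x₂ ▷ z)` -/
  mul_right : ∀ x y z : H,
    p x (y * z) = sweedler ((LinearMap.mul k H).compl₁₂ (p.flip y) (p.flip z)) x
  /-- `x ▷ (y ▷ z) = (x₁ (x₂ ▷ y)) ▷ z` -/
  assoc : ∀ x y z : H,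
    p x (p y z) = p (sweedler ((LinearMap.mul k H).compl₂ (p.flip y)) x) z
  /-- `x ↦ (x ▷ ·)` is convolution invertible in `Hom(H, End(H))`. -/
  convInvertible : IsUnit (WithConv.toConv (p : H →ₗ[k] Module.End k H))

/-- The bilinear operation `x ▷̄ u = P x u` on `U(L)` is the extension of the operation
`x ▷ y = p x y` on the Lie algebra `L`, in the sense that for all `x, z ∈ L` and `u, v, w ∈ U(L)`:
`1 ▷̄ u = u`, `x ▷̄ 1 = 0`, `x ▷̄ (z v) = (x ▷ z) v + z (x ▷̄ v)` and
`(x w) ▷̄ u = x ▷̄ (w ▷̄ u) - (x ▷̄ w) ▷̄ u`. -/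
structure IsPostExtension {k L : Type*} [CommRing k] [LieRing L] [LieAlgebra k L]
    (p : L →ₗ[k] L →ₗ[k] L)
    (P : UniversalEnvelopingAlgebra k L →ₗ[k] UniversalEnvelopingAlgebra k L →ₗ[k]
      UniversalEnvelopingAlgebra k L) : Prop where
  one_left : ∀ u, P 1 u = u
  ι_one : ∀ x : L, P (UniversalEnvelopingAlgebra.ι k x) 1 = 0
  ι_mul : ∀ (x z : L) (v : UniversalEnvelopingAlgebra k L),
    P (UniversalEnvelopingAlgebra.ι k x) (UniversalEnvelopingAlgebra.ι k z * v) =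
      UniversalEnvelopingAlgebra.ι k (p x z) * v +
        UniversalEnvelopingAlgebra.ι k z * P (UniversalEnvelopingAlgebra.ι k x) v
  mul_left : ∀ (x : L) (w u : UniversalEnvelopingAlgebra k L),
    P (UniversalEnvelopingAlgebra.ι k x * w) u =
      P (UniversalEnvelopingAlgebra.ι k x) (P w u) - P (P (UniversalEnvelopingAlgebra.ι k x) w) u

end Notions

/-! Write `⇀` for the extended action. Everything hinges on the recursion `F(1) = 1`, `F(y u) = T(y)
F(u) - F(T(y) ⇀ u)`.

Existence is not evident, because the recursion must respect the relations of `U(𝔥)`. If `F` exists,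
put `Ψ_u(x) = F(x ⇀ u)`; since `⇀` is compatible with products, the recursion gives `Ψ_{yu}(x) =
T(x₁ ⇀ y) Ψ_u(x₂) - Ψ_u(T(x₁ ⇀ y) x₂)`. The right side is an operator `L_y` on `Hom(U(𝔤), U(𝔤))`
that makes sense without `F`. The Rota–Baxter identity says exactly what is needed for `y ↦ L_y` to
be a Lie homomorphism (`coindOp_lie`), so `U(𝔥)` acts on this space. Acting by `u` on `Ψ_1 = ε(·) 1`
and evaluating at `1` defines `F(u)`.

Uniqueness and all further properties follow by an induction adapted to the recursion
(`induct_recursion`). It shows that `F` preserves comultiplication and satisfies the Hopf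
Rota–Baxter identity; conversely, that identity at a primitive `a` is the recursion once `F(1) = 1`
is known. The post-Hopf axioms are formal consequences, with the convolution inverse coming from the
antipode of `U(𝔤)`. The rule for `(x w) ▷̄ u` is the recursion carried through the action, so the
post-Lie extension is unique by the same induction. -/

/-! ### Sweedler notation and coalgebra homomorphisms. -/

section Sweedler

variable {k C D V W : Type*} [CommRing k] [AddCommGroup C] [Module k C] [Coalgebra k C]
  [AddCommGroup D] [Module k D] [Coalgebra k D]
  [AddCommGroup V] [Module k V] [AddCommGroup W] [Module k W]

theorem sweedler_add (f g : C →ₗ[k] C →ₗ[k] V) (a : C) :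
    sweedler (f + g) a = sweedler f a + sweedler g a := by
  simp [sweedler_apply _ (Coalgebra.Repr.arbitrary k a), Finset.sum_add_distrib]

theorem sweedler_smul (c : k) (f : C →ₗ[k] C →ₗ[k] V) (a : C) :
    sweedler (c • f) a = c • sweedler f a := by
  simp [sweedler_apply _ (Coalgebra.Repr.arbitrary k a), Finset.smul_sum]

theorem map_sweedler (g : V →ₗ[k] W) (f : C →ₗ[k] C →ₗ[k] V) (a : C) :
    g (sweedler f a) = sweedler (f.compr₂ g) a := by
  simp [sweedler_apply _ (Coalgebra.Repr.arbitrary k a)]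

theorem IsCoalgHom.sweedler_map {F : C →ₗ[k] D} (hF : IsCoalgHom F) (f : D →ₗ[k] D →ₗ[k] V)
    (a : C) : sweedler f (F a) = sweedler (f.compl₁₂ F F) a := by
  have h : Coalgebra.comul (F a) = TensorProduct.map F F (Coalgebra.comul (R := k) a) :=
    (LinearMap.congr_fun hF.2 a).symm
  rw [sweedler, LinearMap.comp_apply, h, sweedler, LinearMap.comp_apply]
  induction Coalgebra.comul (R := k) a using TensorProduct.induction_on with
  | zero => simp
  | tmul x y => simp
  | add x y hx hy => simp only [map_add, hx, hy]

theorem IsCoalgHom.comp {E : Type*} [AddCommGroup E] [Module k E] [Coalgebra k E]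
    {G : D →ₗ[k] E} {F : C →ₗ[k] D} (hG : IsCoalgHom G) (hF : IsCoalgHom F) :
    IsCoalgHom (G ∘ₗ F) := by
  refine ⟨by rw [← LinearMap.comp_assoc, hG.1, hF.1], ?_⟩
  rw [TensorProduct.map_comp, LinearMap.comp_assoc, hF.2, ← LinearMap.comp_assoc, hG.2,
    LinearMap.comp_assoc]

theorem IsCoalgHom.rTensor {F : C →ₗ[k] D} (hF : IsCoalgHom F) (E : Type*) [AddCommGroup E]
    [Module k E] [Coalgebra k E] : IsCoalgHom (F.rTensor E) := by
  -- Bundling `F` makes the tensor product of coalgebra homomorphisms available.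
  let F' : C →ₗc[k] D := { F with counit_comp := hF.1, map_comp_comul := hF.2 }
  have h : F.rTensor E = (Coalgebra.TensorProduct.map F' (CoalgHom.id k E)).toLinearMap := rfl
  rw [h]
  exact ⟨CoalgHom.counit_comp _, CoalgHom.map_comp_comul _⟩

end Sweedler

/-! ### Induction and Sweedler calculus in enveloping algebras. -/

namespace UniversalEnvelopingAlgebra

variable {k L M : Type*} [CommRing k] [LieRing L] [LieAlgebra k L] [LieRing M] [LieAlgebra k M]

theorem induct_left {P : UniversalEnvelopingAlgebra k L → Prop} (one : P 1)
    (smul : ∀ (c : k) a, P a → P (c • a)) (add : ∀ a b, P a → P b → P (a + b))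
    (mul : ∀ x a, P a → P (ι k x * a)) (a : UniversalEnvelopingAlgebra k L) : P a := by
  suffices h : ∀ b, P b → P (a * b) by simpa using h 1 one
  induction a using induct with
  | algMap r => intro b hb; rw [← Algebra.smul_def]; exact smul r b hb
  | gen x => exact mul x
  | mul a b ha hb => intro c hc; rw [mul_assoc]; exact ha _ (hb _ hc)
  | add a b ha hb => intro c hc; rw [add_mul]; exact add _ _ (ha _ hc) (hb _ hc)

theorem induct_right {P : UniversalEnvelopingAlgebra k L → Prop} (one : P 1)
    (smul : ∀ (c : k) a, P a → P (c • a)) (add : ∀ a b, P a → P b → P (a + b))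
    (mul : ∀ x a, P a → P (a * ι k x)) (a : UniversalEnvelopingAlgebra k L) : P a := by
  suffices h : ∀ b, P b → P (b * a) by simpa using h 1 one
  induction a using induct with
  | algMap r =>
    intro b hb; rw [← Algebra.commutes, ← Algebra.smul_def]; exact smul r b hb
  | gen x => exact mul x
  | mul a b ha hb => intro c hc; rw [← mul_assoc]; exact hb _ (ha _ hc)
  | add a b ha hb => intro c hc; rw [mul_add]; exact add _ _ (ha _ hc) (hb _ hc)

section Sweedler

variable {V : Type*} [AddCommGroup V] [Module k V]
  (f : UniversalEnvelopingAlgebra k L →ₗ[k] UniversalEnvelopingAlgebra k L →ₗ[k] V)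

theorem sweedler_one : sweedler f 1 = f 1 1 := by
  simp [sweedler, Algebra.TensorProduct.one_def]

theorem sweedler_ι (x : L) : sweedler f (ι k x) = f (ι k x) 1 + f 1 (ι k x) := by
  simp [sweedler, comul_ι, -ι_apply]

theorem sweedler_mul_ι (a : UniversalEnvelopingAlgebra k L) (x : L) :
    sweedler f (a * ι k x) = sweedler (f ∘ₗ LinearMap.mulRight k (ι k x)) a +
      sweedler (f.compl₂ (LinearMap.mulRight k (ι k x))) a := by
  simp only [sweedler, LinearMap.comp_apply, Bialgebra.comul_mul, comul_ι]
  induction Coalgebra.comul (R := k) a using TensorProduct.induction_on with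
  | zero => simp
  | tmul a b => simp [mul_add, -ι_apply]
  | add a b ha hb => simp only [add_mul, map_add, ha, hb]; abel

theorem sweedler_ι_mul (x : L) (a : UniversalEnvelopingAlgebra k L) :
    sweedler f (ι k x * a) = sweedler (f ∘ₗ LinearMap.mulLeft k (ι k x)) a +
      sweedler (f.compl₂ (LinearMap.mulLeft k (ι k x))) a := by
  simp only [sweedler, LinearMap.comp_apply, Bialgebra.comul_mul, comul_ι]
  induction Coalgebra.comul (R := k) a using TensorProduct.induction_on with
  | zero => simp
  | tmul a b => simp [add_mul, -ι_apply]
  | add a b ha hb => simp only [mul_add, map_add, ha, hb]; abel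

end Sweedler

/-! ### Extended derivations are coderivations. -/

section Derivations

theorem counit_extDer (D : LieDerivation k M M) (a : UniversalEnvelopingAlgebra k M) :
    Coalgebra.counit (R := k) (extDer D a) = 0 := by
  induction a using induct_left with
  | one => simp [extDer_one]
  | smul c a ha => simp [ha]
  | add a b ha hb => simp [ha, hb]
  | mul x a ha =>
    rw [extDer_mul, extDer_ι, map_add, Bialgebra.counit_mul, Bialgebra.counit_mul, counit_ι,
      counit_ι, zero_mul, zero_mul, add_zero]

theorem comul_extDer (D : LieDerivation k M M) (a : UniversalEnvelopingAlgebra k M) :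
    Coalgebra.comul (R := k) (extDer D a) =
      TensorProduct.map (extDer D) LinearMap.id (Coalgebra.comul (R := k) a) +
      TensorProduct.map LinearMap.id (extDer D) (Coalgebra.comul (R := k) a) := by
  induction a using induct_left with
  | one => simp [extDer_one, Algebra.TensorProduct.one_def]
  | smul c a ha => simp only [map_smul, ha, smul_add]
  | add a b ha hb => simp only [map_add, ha, hb]; abel
  | mul x a ha =>
    rw [extDer_mul, extDer_ι, map_add, Bialgebra.comul_mul, Bialgebra.comul_mul,
      Bialgebra.comul_mul, ha, comul_ι, comul_ι]
    induction Coalgebra.comul (R := k) a using TensorProduct.induction_on with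
    | zero => simp
    | tmul a b =>
      simp only [add_mul, mul_add, Algebra.TensorProduct.tmul_mul_tmul, one_mul, map_add,
        TensorProduct.map_tmul, LinearMap.id_apply, extDer_mul, extDer_ι, TensorProduct.add_tmul,
        TensorProduct.tmul_add]
      abel
    | add a b ha hb =>
      simp only [mul_add, map_add] at ha hb ⊢
      convert congrArg₂ (· + ·) ha hb using 1 <;> abel

theorem sweedler_extDer {V : Type*} [AddCommGroup V] [Module k V]
    (f : UniversalEnvelopingAlgebra k M →ₗ[k] UniversalEnvelopingAlgebra k M →ₗ[k] V)
    (D : LieDerivation k M M) (a : UniversalEnvelopingAlgebra k M) :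
    sweedler f (extDer D a) = sweedler (f ∘ₗ extDer D) a + sweedler (f.compl₂ (extDer D)) a := by
  simp only [sweedler, LinearMap.comp_apply, comul_extDer]
  induction Coalgebra.comul (R := k) a using TensorProduct.induction_on with
  | zero => simp
  | tmul a b => simp
  | add a b ha hb => simp only [map_add] at ha hb ⊢; rw [add_add_add_comm, ha, hb]; abel

end Derivations

/-! ### The module bialgebra structure. -/

section Action

variable (φ : L →ₗ⁅k⁆ LieDerivation k M M)

theorem extAction_mul_apply (x y : UniversalEnvelopingAlgebra k L)
    (a : UniversalEnvelopingAlgebra k M) :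
    extAction φ (x * y) a = extAction φ x (extAction φ y a) := by
  rw [map_mul, Module.End.mul_apply]

theorem extAction_one_right (x : UniversalEnvelopingAlgebra k L) :
    extAction φ x 1 = Coalgebra.counit (R := k) x • (1 : UniversalEnvelopingAlgebra k M) := by
  induction x using induct_right with
  | one => simp
  | smul c a ha => simp [ha, mul_smul]
  | add a b ha hb => simp [ha, hb, add_smul]
  | mul x a ha =>
    rw [extAction_mul_apply, extAction_ι, extDer_one, map_zero, Bialgebra.counit_mul, counit_ι,
      mul_zero, zero_smul]

/-- Peeling a generator off the right of `x` lets it act first, as a derivation. The induction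
hypothesis is then needed for the changed factors, hence the generalization over `a` and `b`. -/
theorem extAction_mul_right (x : UniversalEnvelopingAlgebra k L)
    (a b : UniversalEnvelopingAlgebra k M) :
    extAction φ x (a * b) = sweedler ((LinearMap.mul k _).compl₁₂
      ((extAction φ).toLinearMap.flip a) ((extAction φ).toLinearMap.flip b)) x := by
  induction x using induct_right generalizing a b with
  | one => simp [sweedler_one]
  | smul c x hx => simp only [map_smul, LinearMap.smul_apply, hx]
  | add x y hx hy => simp only [map_add, LinearMap.add_apply, hx, hy]
  | mul z x hx =>
    rw [extAction_mul_apply, extAction_ι, extDer_mul, map_add, hx, hx, sweedler_mul_ι]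
    congr 3 <;>
    · ext p q
      simp [extAction_ι, -ι_apply]

theorem counit_extAction (x : UniversalEnvelopingAlgebra k L)
    (a : UniversalEnvelopingAlgebra k M) : Coalgebra.counit (R := k) (extAction φ x a) =
      Coalgebra.counit (R := k) x * Coalgebra.counit (R := k) a := by
  induction x using induct generalizing a with
  | algMap r => simp [Algebra.algebraMap_eq_smul_one]
  | gen x => rw [extAction_ι, counit_extDer, counit_ι, zero_mul]
  | mul x y hx hy => rw [extAction_mul_apply, hx, hy, Bialgebra.counit_mul, mul_assoc]
  | add x y hx hy => simp only [map_add, LinearMap.add_apply, hx, hy, add_mul]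

/-- The right side is an algebra homomorphism from `U(L)` to the endomorphisms of `U(M) ⊗ U(M)`. In
this form the identity is multiplicative in `x`, and on generators it is the coderivation property.
-/
theorem comul_extAction (x : UniversalEnvelopingAlgebra k L)
    (a : UniversalEnvelopingAlgebra k M) : Coalgebra.comul (R := k) (extAction φ x a) =
      Module.endTensorEndAlgHom (R := k) (S := k) (A := k)
        (Algebra.TensorProduct.map (extAction φ) (extAction φ) (Coalgebra.comul (R := k) x))
        (Coalgebra.comul (R := k) a) := by
  induction x using induct generalizing a with
  | algMap r => simp [Algebra.algebraMap_eq_smul_one, -Algebra.TensorProduct.map_tmul]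
  | gen x =>
    rw [extAction_ι, comul_extDer, comul_ι]
    simp only [map_add, Algebra.TensorProduct.map_tmul, extAction_ι, map_one,
      Module.endTensorEndAlgHom_apply]
    rfl
  | mul x y hx hy =>
    rw [extAction_mul_apply, hx, hy, Bialgebra.comul_mul, map_mul, map_mul, Module.End.mul_apply]
  | add x y hx hy => simp only [map_add, LinearMap.add_apply, hx, hy]

theorem isModuleBialgebra_extAction : IsModuleBialgebra (extAction φ) where
  act_mul := extAction_mul_right φ
  act_one := extAction_one_right φ
  isCoalgHom := by
    constructor
    · ext x a
      simp [counit_extAction, mul_comm]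
    · refine TensorProduct.ext' fun x a => ?_
      simp only [LinearMap.comp_apply, TensorProduct.comul_tmul, TensorProduct.lift.tmul,
        AlgHom.toLinearMap_apply, comul_extAction]
      induction Coalgebra.comul (R := k) x using TensorProduct.induction_on with
      | zero => simp
      | add x y hx hy => simp only [TensorProduct.add_tmul, map_add, hx, hy, LinearMap.add_apply]
      | tmul x y =>
        induction Coalgebra.comul (R := k) a using TensorProduct.induction_on with
        | zero => simp
        | add a b ha hb => simp only [TensorProduct.tmul_add, map_add, ha, hb]
        | tmul a b => simp; rfl

end Action

end UniversalEnvelopingAlgebra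

/-! ### The operators `L_y` and their commutators. -/

namespace UniversalEnvelopingAlgebra

variable {k 𝔤 𝔥 : Type*} [CommRing k] [LieRing 𝔤] [LieAlgebra k 𝔤] [LieRing 𝔥] [LieAlgebra k 𝔥]

section Construction

/-- The action of `U(𝔤)` on the vector space `𝔥` given by an action of `𝔤` by derivations. -/
noncomputable def derAction (φ : 𝔤 →ₗ⁅k⁆ LieDerivation k 𝔥 𝔥) :
    UniversalEnvelopingAlgebra k 𝔤 →ₐ[k] Module.End k 𝔥 :=
  lift k ((LieDerivation.toLinearMapLieHom k 𝔥).comp φ)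

theorem derAction_ι (φ : 𝔤 →ₗ⁅k⁆ LieDerivation k 𝔥 𝔥) (x : 𝔤) (y : 𝔥) :
    derAction φ (ι k x) y = φ x y := by
  rw [derAction, lift_ι_apply]; rfl

variable (φ : 𝔤 →ₗ⁅k⁆ LieDerivation k 𝔥 𝔥) (T : 𝔥 →ₗ[k] 𝔤)

/-- The bilinear map `(p, q) ↦ T(p ⇀ y) Ψ(q) - Ψ(T(p ⇀ y) q)`. -/
noncomputable def coindBilin (y : 𝔥)
    (Ψ : UniversalEnvelopingAlgebra k 𝔤 →ₗ[k] UniversalEnvelopingAlgebra k 𝔤) :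
    UniversalEnvelopingAlgebra k 𝔤 →ₗ[k] UniversalEnvelopingAlgebra k 𝔤 →ₗ[k]
      UniversalEnvelopingAlgebra k 𝔤 :=
  LinearMap.mk₂ k
    (fun p q => ι k (T (derAction φ p y)) * Ψ q - Ψ (ι k (T (derAction φ p y)) * q))
    (fun p p' q => by simp only [map_add, LinearMap.add_apply, add_mul]; abel)
    (fun c p q => by
      simp only [map_smul, LinearMap.smul_apply, smul_mul_assoc, smul_sub])
    (fun p q q' => by simp only [map_add, mul_add]; abel)
    (fun c p q => by simp only [map_smul, mul_smul_comm, smul_sub])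

theorem coindBilin_apply (y : 𝔥)
    (Ψ : UniversalEnvelopingAlgebra k 𝔤 →ₗ[k] UniversalEnvelopingAlgebra k 𝔤)
    (p q : UniversalEnvelopingAlgebra k 𝔤) :
    coindBilin φ T y Ψ p q =
      ι k (T (derAction φ p y)) * Ψ q - Ψ (ι k (T (derAction φ p y)) * q) := rfl

/-- The operators `(L_y Ψ)(x) = T(x₁ ⇀ y) Ψ(x₂) - Ψ(T(x₁ ⇀ y) x₂)` on `Hom(U(𝔤), U(𝔤))`. -/
noncomputable def coindOp : 𝔥 →ₗ[k]
    Module.End k (UniversalEnvelopingAlgebra k 𝔤 →ₗ[k] UniversalEnvelopingAlgebra k 𝔤) :=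
  LinearMap.mk₂ k (fun y Ψ => sweedler (coindBilin φ T y Ψ))
    (fun y y' Ψ => by
      ext1 x
      rw [LinearMap.add_apply, ← sweedler_add]
      congr 1
      congr 1
      ext p q : 2
      simp only [coindBilin_apply, LinearMap.add_apply, map_add, add_mul]; abel)
    (fun c y Ψ => by
      ext1 x
      rw [LinearMap.smul_apply, ← sweedler_smul]
      congr 1
      congr 1
      ext p q : 2
      simp only [coindBilin_apply, LinearMap.smul_apply, map_smul, smul_mul_assoc, smul_sub])
    (fun y Ψ Ψ' => by
      ext1 x
      rw [LinearMap.add_apply, ← sweedler_add]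
      congr 1
      congr 1
      ext p q : 2
      simp only [coindBilin_apply, LinearMap.add_apply, mul_add]; abel)
    (fun c y Ψ => by
      ext1 x
      rw [LinearMap.smul_apply, ← sweedler_smul]
      congr 1
      congr 1
      ext p q : 2
      simp only [coindBilin_apply, LinearMap.smul_apply, mul_smul_comm, smul_sub])

theorem coindOp_apply_one (y : 𝔥)
    (Ψ : UniversalEnvelopingAlgebra k 𝔤 →ₗ[k] UniversalEnvelopingAlgebra k 𝔤) :
    coindOp φ T y Ψ 1 = ι k (T y) * Ψ 1 - Ψ (ι k (T y)) := by
  change sweedler (coindBilin φ T y Ψ) 1 = _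
  rw [sweedler_one, coindBilin_apply, map_one, Module.End.one_apply, mul_one]

/-- Since `z` is primitive, in `Δ(x z)` it joins either the first leg, turning `y` into `φ(z) y`, or
the second, where it is absorbed into `Ψ`. Thus precomposition with right multiplication by `z`
obeys a Leibniz rule, which allows induction on `x`. -/
theorem coindOp_apply_mul_ι (y : 𝔥)
    (Ψ : UniversalEnvelopingAlgebra k 𝔤 →ₗ[k] UniversalEnvelopingAlgebra k 𝔤)
    (x : UniversalEnvelopingAlgebra k 𝔤) (z : 𝔤) :
    coindOp φ T y Ψ (x * ι k z) = coindOp φ T (φ z y) Ψ x +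
      coindOp φ T y (Ψ ∘ₗ LinearMap.mulRight k (ι k z)) x := by
  change sweedler (coindBilin φ T y Ψ) (x * ι k z) = sweedler (coindBilin φ T (φ z y) Ψ) x +
    sweedler (coindBilin φ T y (Ψ ∘ₗ LinearMap.mulRight k (ι k z))) x
  rw [sweedler_mul_ι]
  congr 3
  · ext p q : 2
    simp only [LinearMap.comp_apply, LinearMap.mulRight_apply, coindBilin_apply, map_mul,
      Module.End.mul_apply, derAction_ι]
  · ext p q : 2
    simp only [LinearMap.compl₂_apply, LinearMap.comp_apply, LinearMap.mulRight_apply,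
      coindBilin_apply, mul_assoc]

theorem coindOp_comp_mulRight (y : 𝔥)
    (Ψ : UniversalEnvelopingAlgebra k 𝔤 →ₗ[k] UniversalEnvelopingAlgebra k 𝔤) (z : 𝔤) :
    coindOp φ T y Ψ ∘ₗ LinearMap.mulRight k (ι k z) = coindOp φ T (φ z y) Ψ +
      coindOp φ T y (Ψ ∘ₗ LinearMap.mulRight k (ι k z)) :=
  LinearMap.ext fun x => coindOp_apply_mul_ι φ T y Ψ x z

variable {φ T} in
-- Both sides obey the same Leibniz rule under right multiplication of `x` by `z`, because `φ(z)` is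
-- a derivation of the bracket. This reduces the claim to `x = 1`, for all `a`, `b`, `Ψ`, where it
-- is the Rota–Baxter identity.
theorem coindOp_lie (hT : IsLieRelRotaBaxter φ T) (a b : 𝔥) :
    coindOp φ T ⁅a, b⁆ = ⁅coindOp φ T a, coindOp φ T b⁆ := by
  rw [LieRing.of_associative_ring_bracket]
  suffices h : ∀ (x : UniversalEnvelopingAlgebra k 𝔤) (a b : 𝔥)
      (Ψ : UniversalEnvelopingAlgebra k 𝔤 →ₗ[k] UniversalEnvelopingAlgebra k 𝔤),
      coindOp φ T ⁅a, b⁆ Ψ x =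
        coindOp φ T a (coindOp φ T b Ψ) x - coindOp φ T b (coindOp φ T a Ψ) x from
    LinearMap.ext fun Ψ => LinearMap.ext fun x => h x a b Ψ
  intro x
  induction x using induct_right with
  | one =>
    intro a b Ψ
    -- A composite of two operators at `1` evaluates the inner one at an element of `𝔤`; the Leibniz
    -- rule brings this back to values at `1`.
    have hι : ∀ (u v : 𝔥), coindOp φ T u Ψ (ι k (T v)) = coindOp φ T (φ (T v) u) Ψ 1 +
        coindOp φ T u (Ψ ∘ₗ LinearMap.mulRight k (ι k (T v))) 1 := fun u v => by
      rw [← coindOp_apply_mul_ι, one_mul]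
    have hab : ⁅ι k (T a), ι k (T b)⁆ =
        ι k (T (φ (T a) b)) - ι k (T (φ (T b) a)) + ι k (T ⁅a, b⁆) := by
      rw [← LieHom.map_lie, hT]; simp only [map_add, map_sub]
    rw [LieRing.of_associative_ring_bracket] at hab
    have hab' : ι k (T ⁅a, b⁆) = ι k (T a) * ι k (T b) - ι k (T b) * ι k (T a) -
        ι k (T (φ (T a) b)) + ι k (T (φ (T b) a)) := by rw [hab]; abel
    simp only [coindOp_apply_one, hι, LinearMap.comp_apply, LinearMap.mulRight_apply, one_mul,
      hab', map_add, map_sub, add_mul, sub_mul, mul_sub, mul_assoc]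
    abel
  | smul c x hx => intro a b Ψ; simp only [map_smul, hx, smul_sub]
  | add x y hx hy => intro a b Ψ; simp only [map_add, hx, hy]; abel
  | mul z x hx =>
    intro a b Ψ
    simp only [coindOp_apply_mul_ι, coindOp_comp_mulRight, map_add, LinearMap.add_apply, hx,
      LieDerivation.apply_lie_eq_add]
    abel

end Construction

end UniversalEnvelopingAlgebra

/-! ### The recursion: existence, uniqueness and consequences. -/

namespace UniversalEnvelopingAlgebra

variable {k 𝔤 𝔥 : Type*} [CommRing k] [LieRing 𝔤] [LieAlgebra k 𝔤] [LieRing 𝔥] [LieAlgebra k 𝔥]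

section Recursion

variable (φ : 𝔤 →ₗ⁅k⁆ LieDerivation k 𝔥 𝔥) (T : 𝔥 →ₗ[k] 𝔤)

/-- The recursion `F(1) = 1`, `F(y u) = T(y) F(u) - F(T(y) ⇀ u)`. -/
def IsRecursiveExtension
    (F : UniversalEnvelopingAlgebra k 𝔥 →ₗ[k] UniversalEnvelopingAlgebra k 𝔤) : Prop :=
  F 1 = 1 ∧ ∀ (y : 𝔥) (u : UniversalEnvelopingAlgebra k 𝔥),
    F (ι k y * u) = ι k (T y) * F u - F (extAction φ (ι k (T y)) u)

variable {φ T}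

/-- The algebra homomorphism `U(𝔥) → End(Hom(U(𝔤), U(𝔤)))` that extends `coindOp`. -/
noncomputable def coindRep (hT : IsLieRelRotaBaxter φ T) :
    UniversalEnvelopingAlgebra k 𝔥 →ₐ[k]
      Module.End k (UniversalEnvelopingAlgebra k 𝔤 →ₗ[k] UniversalEnvelopingAlgebra k 𝔤) :=
  lift k { coindOp φ T with map_lie' := fun {a b} => coindOp_lie hT a b }

theorem coindRep_ι (hT : IsLieRelRotaBaxter φ T) (y : 𝔥) :
    coindRep hT (ι k y) = coindOp φ T y := by
  rw [coindRep, lift_ι_apply]; rfl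

/-- The Leibniz rule for the operators `L_y` propagates to products. It identifies the value of `u ·
Ψ_1` at `z` with `F(z ⇀ u)`, as the recursion requires. -/
theorem coindRep_comp_mulRight (hT : IsLieRelRotaBaxter φ T) (u : UniversalEnvelopingAlgebra k 𝔥)
    (Ψ : UniversalEnvelopingAlgebra k 𝔤 →ₗ[k] UniversalEnvelopingAlgebra k 𝔤) (z : 𝔤) :
    coindRep hT u Ψ ∘ₗ LinearMap.mulRight k (ι k z) = coindRep hT (extDer (φ z) u) Ψ +
      coindRep hT u (Ψ ∘ₗ LinearMap.mulRight k (ι k z)) := by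
  induction u using induct generalizing Ψ with
  | algMap r =>
    rw [extDer_algebraMap, map_zero, LinearMap.zero_apply, zero_add, AlgHom.commutes]
    rfl
  | gen y => rw [extDer_ι, coindRep_ι, coindRep_ι, coindOp_comp_mulRight]
  | mul a b ha hb =>
    simp only [map_mul, Module.End.mul_apply, ha, hb, extDer_mul, map_add, LinearMap.add_apply]
    abel
  | add a b ha hb =>
    simp only [map_add, LinearMap.add_apply, LinearMap.add_comp, ha, hb]
    abel

/-- The extension of a relative Rota–Baxter operator `T : 𝔥 → 𝔤` to a map `U(𝔥) → U(𝔤)`. -/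
noncomputable def rotaBaxterExtension (hT : IsLieRelRotaBaxter φ T) :
    UniversalEnvelopingAlgebra k 𝔥 →ₗ[k] UniversalEnvelopingAlgebra k 𝔤 :=
  LinearMap.applyₗ 1 ∘ₗ
    (coindRep hT).toLinearMap.flip (Algebra.linearMap k _ ∘ₗ Coalgebra.counit)

theorem isRecursiveExtension_rotaBaxterExtension (hT : IsLieRelRotaBaxter φ T) :
    IsRecursiveExtension φ T (rotaBaxterExtension hT) := by
  have happ : ∀ u, rotaBaxterExtension hT u =
    coindRep hT u (Algebra.linearMap k _ ∘ₗ Coalgebra.counit) 1 := fun _ => rfl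
  refine ⟨by simp [happ], fun y u => ?_⟩
  rw [happ, map_mul, Module.End.mul_apply, coindRep_ι, coindOp_apply_one, ← happ, extAction_ι]
  congr 1
  have h := LinearMap.congr_fun (coindRep_comp_mulRight hT u
    (Algebra.linearMap k _ ∘ₗ Coalgebra.counit) (T y)) 1
  -- The starting vector is killed by right multiplication by elements of `𝔤`, since `ε(x z) = ε(x)
  -- ε(z) = 0`.
  have h0 : (Algebra.linearMap k (UniversalEnvelopingAlgebra k 𝔤) ∘ₗ Coalgebra.counit) ∘ₗ
      LinearMap.mulRight k (ι k (T y)) = 0 := by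
    ext1 x
    simp [counit_ι, -ι_apply]
  rw [h0, map_zero, add_zero, LinearMap.comp_apply, LinearMap.mulRight_apply, one_mul] at h
  rw [h, happ]

variable (φ T) in
-- The action does not raise the degree, so `T(y) ⇀ u` is no more complex than `u`. Instead of a
-- filtration, the proof strengthens the claim to all `x ⇀ u` with `x ∈ U(𝔤)`.
theorem induct_recursion {P : UniversalEnvelopingAlgebra k 𝔥 → Prop} (one : P 1)
    (smul : ∀ (c : k) a, P a → P (c • a)) (add : ∀ a b, P a → P b → P (a + b))
    (mul : ∀ y u, P u → P (extAction φ (ι k (T y)) u) → P (ι k y * u))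
    (u : UniversalEnvelopingAlgebra k 𝔥) : P u := by
  suffices h : ∀ x, P (extAction φ x u) by simpa using h 1
  induction u using induct_left with
  | one =>
    intro x
    rw [extAction_one_right]
    exact smul _ _ one
  | smul c a ha => intro x; rw [map_smul]; exact smul c _ (ha x)
  | add a b ha hb => intro x; rw [map_add]; exact add _ _ (ha x) (hb x)
  | mul y a ha =>
    intro x
    induction x using induct_right generalizing y a with
    | one =>
      have h1 := ha 1
      rw [map_one, Module.End.one_apply] at h1 ⊢
      exact mul y a h1 (ha _)
    | smul c x hx => rw [map_smul]; exact smul c _ (hx y a ha)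
    | add x x' hx hx' => rw [map_add]; exact add _ _ (hx y a ha) (hx' y a ha)
    | mul z x hx =>
      rw [extAction_mul_apply, extAction_ι, extDer_mul, extDer_ι, map_add]
      -- The hypothesis on `a` covers its whole orbit, so it passes to `z ⇀ a` because `x' ⇀ (z ⇀ a)
      -- = (x' z) ⇀ a`.
      refine add _ _ (hx _ _ ha) (hx _ _ fun x' => ?_)
      rw [← extAction_ι, ← extAction_mul_apply]
      exact ha _

variable {F : UniversalEnvelopingAlgebra k 𝔥 →ₗ[k] UniversalEnvelopingAlgebra k 𝔤}

namespace IsRecursiveExtension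

theorem unique {G : UniversalEnvelopingAlgebra k 𝔥 →ₗ[k] UniversalEnvelopingAlgebra k 𝔤}
    (hF : IsRecursiveExtension φ T F) (hG : IsRecursiveExtension φ T G) : F = G := by
  ext1 u
  induction u using induct_recursion φ T with
  | one => rw [hF.1, hG.1]
  | smul c a ha => rw [map_smul, map_smul, ha]
  | add a b ha hb => rw [map_add, map_add, ha, hb]
  | mul y u hu hu' => rw [hF.2, hG.2, hu, hu']

theorem map_ι (hF : IsRecursiveExtension φ T F) (y : 𝔥) : F (ι k y) = ι k (T y) := by
  have h := hF.2 y 1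
  rwa [mul_one, hF.1, mul_one, extAction_ι, extDer_one, map_zero, sub_zero] at h

theorem isCoalgHom (hF : IsRecursiveExtension φ T F) : IsCoalgHom F := by
  refine ⟨LinearMap.ext fun u => ?_, LinearMap.ext fun u => ?_⟩ <;>
    rw [LinearMap.comp_apply]
  · induction u using induct_recursion φ T with
    | one => simp [hF.1]
    | smul c a ha => rw [map_smul, map_smul, ha, map_smul]
    | add a b ha hb => rw [map_add, map_add, ha, hb, map_add]
    | mul y u hu hu' =>
      rw [hF.2, map_sub, hu', Bialgebra.counit_mul, Bialgebra.counit_mul, counit_ι, counit_ι,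
        counit_extAction, counit_ι]
      simp
  · rw [LinearMap.comp_apply]
    induction u using induct_recursion φ T with
    | one => simp [hF.1, Algebra.TensorProduct.one_def]
    | smul c a ha => simp only [map_smul, ha]
    | add a b ha hb => simp only [map_add, ha, hb]
    | mul y u hu hu' =>
      rw [hF.2, map_sub, ← hu', Bialgebra.comul_mul, Bialgebra.comul_mul, ← hu, extAction_ι,
        comul_extDer, comul_ι, comul_ι]
      induction Coalgebra.comul (R := k) u using TensorProduct.induction_on with
      | zero => simp
      | tmul a b =>
        simp only [add_mul, Algebra.TensorProduct.tmul_mul_tmul, one_mul, map_add,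
          TensorProduct.map_tmul, LinearMap.id_apply, hF.2, TensorProduct.sub_tmul,
          TensorProduct.tmul_sub, extAction_ι]
        abel
      | add a b ha hb =>
        simp only [mul_add, map_add] at ha hb ⊢
        rw [ha, hb]
        abel

theorem map_mul_map (hF : IsRecursiveExtension φ T F) (a b : UniversalEnvelopingAlgebra k 𝔥) :
    F a * F b = F (sweedler ((LinearMap.mul k _).compl₂
      ((extAction φ).toLinearMap.flip b ∘ₗ F)) a) := by
  set f := (LinearMap.mul k _).compl₂ ((extAction φ).toLinearMap.flip b ∘ₗ F) with hf
  have hf' : ∀ p q, f p q = p * extAction φ (F q) b := fun _ _ => rfl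
  induction a using induct_recursion φ T with
  | one => rw [sweedler_one, hf', hF.1, one_mul, one_mul, map_one, Module.End.one_apply]
  | smul c a ha => simp only [map_smul, smul_mul_assoc, ha]
  | add a a' ha ha' => simp only [map_add, add_mul, ha, ha']
  | mul y a ha ha' =>
    -- With `S(a) = a₁ (F(a₂) ⇀ b)`, this reads `S(y a) + S(T(y) ⇀ a) = y S(a) + T(y) ⇀ S(a)`.
    -- Applying `F` and the recursion to `y S(a)` cancels `F(T(y) ⇀ S(a))`.
    have key : sweedler f (ι k y * a) + sweedler f (extAction φ (ι k (T y)) a) =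
        ι k y * sweedler f a + extAction φ (ι k (T y)) (sweedler f a) := by
      have h1 : ι k y * sweedler f a = LinearMap.mulLeft k (ι k y) (sweedler f a) := rfl
      rw [h1, map_sweedler, map_sweedler, sweedler_ι_mul, extAction_ι, sweedler_extDer,
        ← sweedler_add, ← sweedler_add, ← sweedler_add, ← sweedler_add]
      congr 2
      ext p q : 2
      simp only [LinearMap.add_apply, LinearMap.comp_apply, LinearMap.compl₂_apply,
        LinearMap.compr₂_apply, hf', LinearMap.mulLeft_apply, hF.2, extDer_mul, map_sub,
        extAction_mul_apply, extAction_ι, LinearMap.sub_apply, mul_sub, mul_assoc]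
      abel
    rw [eq_sub_of_add_eq key, map_sub, map_add, hF.2, hF.2, ← ha, ← ha', sub_mul, mul_assoc]
    abel

theorem isRelRotaBaxter (hF : IsRecursiveExtension φ T F) :
    IsRelRotaBaxter (extAction φ) F where
  isModuleBialgebra := isModuleBialgebra_extAction φ
  isCoalgHom := hF.isCoalgHom
  map_mul_map := hF.map_mul_map

end IsRecursiveExtension

/-- As the image of a group-like element, `F(1)` is group-like and hence invertible; the Rota–Baxter
identity at `1, 1` makes it idempotent. -/
theorem _root_.IsRelRotaBaxter.map_one (hF : IsRelRotaBaxter (extAction φ) F) : F 1 = 1 := by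
  have hc : Coalgebra.counit (R := k) (F 1) = 1 := by
    rw [← LinearMap.comp_apply, hF.isCoalgHom.1, Bialgebra.counit_one]
  have hg : IsGroupLikeElem k (F 1) :=
    ⟨hc, by simpa [Algebra.TensorProduct.one_def] using
      (LinearMap.congr_fun hF.isCoalgHom.2 1).symm⟩
  have hm := hF.map_mul_map 1 1
  rw [sweedler_one] at hm
  have h1 : extAction φ (F 1) 1 = (1 : UniversalEnvelopingAlgebra k 𝔥) := by
    rw [extAction_one_right, hc, one_smul]
  simp only [LinearMap.compl₂_apply, LinearMap.comp_apply, LinearMap.flip_apply,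
    AlgHom.toLinearMap_apply, h1, LinearMap.mul_apply', one_mul] at hm
  exact hg.isUnit.mul_left_cancel (hm.trans (mul_one _).symm)

theorem _root_.IsRelRotaBaxter.isRecursiveExtension (hF : IsRelRotaBaxter (extAction φ) F)
    (hι : ∀ y, F (ι k y) = ι k (T y)) : IsRecursiveExtension φ T F := by
  refine ⟨hF.map_one, fun y u => ?_⟩
  rw [← hι, hF.map_mul_map, sweedler_ι, map_add]
  simp [hF.map_one, -ι_apply]

end Recursion

end UniversalEnvelopingAlgebra

/-! ### Post-Hopf structures from relative Rota–Baxter operators. -/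

section PostHopf

variable {k H K : Type*} [CommRing k] [Ring H] [HopfAlgebra k H] [Ring K] [HopfAlgebra k K]

/-- Convolution is respected by precomposition with a coalgebra homomorphism and postcomposition
with an algebra homomorphism. Taking the identity and the antipode for `X`, `Y`, in both orders,
yields a two-sided convolution inverse. -/
theorem IsCoalgHom.toConv_comp_mul_toConv_comp {A : Type*} [Ring A] [Algebra k A]
    {F : K →ₗ[k] H} (hF : IsCoalgHom F) (h : H →ₐ[k] A) {X Y : H →ₗ[k] H}
    (hXY : WithConv.toConv X * WithConv.toConv Y = 1) :
    WithConv.toConv (h.toLinearMap ∘ₗ X ∘ₗ F) * WithConv.toConv (h.toLinearMap ∘ₗ Y ∘ₗ F) = 1 := by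
  apply WithConv.ofConv_injective
  refine LinearMap.ext fun c => ?_
  have h1 := congrArg (fun Z : WithConv (H →ₗ[k] H) => h (Z.ofConv (F c))) hXY
  simp only [LinearMap.convMul_def, LinearMap.convOne_def, WithConv.ofConv_toConv,
    LinearMap.comp_apply, Algebra.linearMap_apply, AlgHom.commutes] at h1 ⊢
  rw [← LinearMap.comp_apply Coalgebra.counit F, hF.1] at h1
  rw [← h1, ← LinearMap.comp_apply Coalgebra.comul F, ← hF.2, LinearMap.comp_apply]
  induction Coalgebra.comul (R := k) c using TensorProduct.induction_on with
  | zero => simp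
  | tmul a b => simp
  | add a b ha hb => simp only [map_add, ha, hb]

theorem IsRelRotaBaxter.isPostHopf {act : H →ₐ[k] Module.End k K} {F : K →ₗ[k] H}
    (hF : IsRelRotaBaxter act F) : IsPostHopf (hopfPostProduct act F) where
  isCoalgHom := by
    have h : TensorProduct.lift (hopfPostProduct act F) =
        TensorProduct.lift act.toLinearMap ∘ₗ F.rTensor K := by
      ext a b
      rfl
    rw [h]
    exact hF.isModuleBialgebra.isCoalgHom.comp (hF.isCoalgHom.rTensor K)
  mul_right x y z := by
    change act (F x) (y * z) = _
    rw [hF.isModuleBialgebra.act_mul, hF.isCoalgHom.sweedler_map]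
    rfl
  assoc x y z := by
    change act (F x) (act (F y) z) = act (F _) z
    rw [← Module.End.mul_apply, ← map_mul, hF.map_mul_map]
    rfl
  convInvertible := by
    have h1 := hF.isCoalgHom.toConv_comp_mul_toConv_comp act
      (LinearMap.id_mul_antipode (R := k) (C := H))
    have h2 := hF.isCoalgHom.toConv_comp_mul_toConv_comp act
      (LinearMap.antipode_mul_id (R := k) (C := H))
    exact ⟨⟨_, _, h1, h2⟩, rfl⟩

end PostHopf

/-! ### Comparison with the post-Lie extension. -/

namespace UniversalEnvelopingAlgebra

variable {k 𝔤 𝔥 : Type*} [CommRing k] [LieRing 𝔤] [LieAlgebra k 𝔤] [LieRing 𝔥] [LieAlgebra k 𝔥]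
  {φ : 𝔤 →ₗ⁅k⁆ LieDerivation k 𝔥 𝔥} {T : 𝔥 →ₗ[k] 𝔤}

theorem _root_.IsLieRelRotaBaxter.isPostLie (hT : IsLieRelRotaBaxter φ T) :
    IsPostLie (liePostProduct φ T) where
  lie_right x y z := by
    simp only [liePostProduct, LinearMap.mk₂_apply, LieDerivation.apply_lie_eq_add]
    rw [add_comm]
  lie_left x y z := by
    simp only [liePostProduct, LinearMap.mk₂_apply]
    have h : ⁅x, y⁆ + φ (T x) y - φ (T y) x = φ (T x) y - φ (T y) x + ⁅x, y⁆ := by abel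
    rw [h, ← hT, LieHom.map_lie, LieDerivation.lie_apply]

theorem _root_.IsPostExtension.ι_left {p : 𝔥 →ₗ[k] 𝔥 →ₗ[k] 𝔥}
    {P Q : UniversalEnvelopingAlgebra k 𝔥 →ₗ[k] UniversalEnvelopingAlgebra k 𝔥 →ₗ[k]
      UniversalEnvelopingAlgebra k 𝔥}
    (hP : IsPostExtension p P) (hQ : IsPostExtension p Q) (x : 𝔥) :
    P (ι k x) = Q (ι k x) := by
  ext1 u
  induction u using induct_left with
  | one => rw [hP.ι_one, hQ.ι_one]
  | smul c a ha => rw [map_smul, map_smul, ha]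
  | add a b ha hb => rw [map_add, map_add, ha, hb]
  | mul z v hv => rw [hP.ι_mul, hQ.ι_mul, hv]

variable {F : UniversalEnvelopingAlgebra k 𝔥 →ₗ[k] UniversalEnvelopingAlgebra k 𝔤}

theorem IsRecursiveExtension.isPostExtension (hF : IsRecursiveExtension φ T F) :
    IsPostExtension (liePostProduct φ T) (hopfPostProduct (extAction φ) F) where
  one_left u := by simp [hopfPostProduct, hF.1]
  ι_one x := by
    simp only [hopfPostProduct, LinearMap.comp_apply, AlgHom.toLinearMap_apply, hF.map_ι,
      extAction_ι, extDer_one]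
  ι_mul x z v := by
    simp only [hopfPostProduct, LinearMap.comp_apply, AlgHom.toLinearMap_apply, hF.map_ι,
      extAction_ι, extDer_mul, extDer_ι]
    rfl
  mul_left x w u := by
    simp only [hopfPostProduct, LinearMap.comp_apply, AlgHom.toLinearMap_apply, hF.map_ι, hF.2,
      map_sub, LinearMap.sub_apply, extAction_mul_apply]

/-- The axioms determine the operation of each `x ∈ 𝔥`, so `x ▷̄ w = T(x) ⇀ w`. The rule for `(x w)
▷̄ u` then involves only `w` and `T(x) ⇀ w` on the left, which is the pattern of `induct_recursion`.
-/
theorem IsRecursiveExtension.eq_of_isPostExtension (hF : IsRecursiveExtension φ T F)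
    {P : UniversalEnvelopingAlgebra k 𝔥 →ₗ[k] UniversalEnvelopingAlgebra k 𝔥 →ₗ[k]
      UniversalEnvelopingAlgebra k 𝔥} (hP : IsPostExtension (liePostProduct φ T) P) :
    P = hopfPostProduct (extAction φ) F := by
  have hQ := hF.isPostExtension
  refine LinearMap.ext fun w => ?_
  induction w using induct_recursion φ T with
  | one => exact LinearMap.ext fun u => by rw [hP.one_left, hQ.one_left]
  | smul c a ha => rw [map_smul, map_smul, ha]
  | add a b ha hb => rw [map_add, map_add, ha, hb]
  | mul x w hw hw' =>
    refine LinearMap.ext fun u => ?_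
    have hx : hopfPostProduct (extAction φ) F (ι k x) w = extAction φ (ι k (T x)) w := by
      rw [hopfPostProduct, LinearMap.comp_apply, hF.map_ι, AlgHom.toLinearMap_apply]
    rw [hP.mul_left, hQ.mul_left, hP.ι_left hQ, hw, hx, hw']

end UniversalEnvelopingAlgebra

theorem mainTheorem7 {k : Type*} [Field k] [IsAlgClosed k] [CharZero k]
    {𝔤 𝔥 : Type*} [LieRing 𝔤] [LieAlgebra k 𝔤] [LieRing 𝔥] [LieAlgebra k 𝔥]
    (φ : 𝔤 →ₗ⁅k⁆ LieDerivation k 𝔥 𝔥) (T : 𝔥 →ₗ[k] 𝔤) (hT : IsLieRelRotaBaxter φ T) :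
    IsModuleBialgebra (UniversalEnvelopingAlgebra.extAction φ) ∧
    IsPostLie (liePostProduct φ T) ∧
    ∃ Tbar : UniversalEnvelopingAlgebra k 𝔥 →ₗ[k] UniversalEnvelopingAlgebra k 𝔤,
      -- `Tbar` is the unique relative Rota–Baxter operator that extends `T`
      (∀ F : UniversalEnvelopingAlgebra k 𝔥 →ₗ[k] UniversalEnvelopingAlgebra k 𝔤,
        (IsRelRotaBaxter (UniversalEnvelopingAlgebra.extAction φ) F ∧
          ∀ y : 𝔥, F (UniversalEnvelopingAlgebra.ι k y) =
            UniversalEnvelopingAlgebra.ι k (T y)) ↔ F = Tbar) ∧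
      -- `Tbar` is the linear map given by the recursion
      (∀ F : UniversalEnvelopingAlgebra k 𝔥 →ₗ[k] UniversalEnvelopingAlgebra k 𝔤,
        (F 1 = 1 ∧ ∀ (y : 𝔥) (u : UniversalEnvelopingAlgebra k 𝔥),
          F (UniversalEnvelopingAlgebra.ι k y * u) =
            UniversalEnvelopingAlgebra.ι k (T y) * F u -
              F (UniversalEnvelopingAlgebra.extAction φ
                (UniversalEnvelopingAlgebra.ι k (T y)) u)) ↔ F = Tbar) ∧
      -- the operation induced by `Tbar` is a post-Hopf structure on `U(𝔥)`
      IsPostHopf (hopfPostProduct (UniversalEnvelopingAlgebra.extAction φ) Tbar) ∧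
      -- and it is the (one and only) extension to `U(𝔥)` of the post-Lie operation induced by `T`
      (∀ P : UniversalEnvelopingAlgebra k 𝔥 →ₗ[k] UniversalEnvelopingAlgebra k 𝔥 →ₗ[k]
          UniversalEnvelopingAlgebra k 𝔥,
        IsPostExtension (liePostProduct φ T) P ↔
          P = hopfPostProduct (UniversalEnvelopingAlgebra.extAction φ) Tbar) := by
  have hF := UniversalEnvelopingAlgebra.isRecursiveExtension_rotaBaxterExtension hT
  refine ⟨UniversalEnvelopingAlgebra.isModuleBialgebra_extAction φ, hT.isPostLie,
    UniversalEnvelopingAlgebra.rotaBaxterExtension hT, fun F => ⟨fun h => ?_, ?_⟩,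
    fun F => ⟨fun h => ?_, ?_⟩, hF.isRelRotaBaxter.isPostHopf,
    fun P => ⟨hF.eq_of_isPostExtension, ?_⟩⟩
  · exact (h.1.isRecursiveExtension h.2).unique hF
  · rintro rfl
    exact ⟨hF.isRelRotaBaxter, hF.map_ι⟩
  · exact UniversalEnvelopingAlgebra.IsRecursiveExtension.unique h hF
  · rintro rfl
    exact hF
  · rintro rfl
    exact hF.isPostExtension
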